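/- Let $\mathcal K_1=L^2([0,2\pi],dk/2\pi)$ (complex-valued functions), and let $P$ be the self-adjoint operator $Pf=-if'$ on $\mathcal K_1$ with domain $D(P)=\{f\in AC[0,2\pi]\mid f'\in\mathcal K_1,\ f(0)=f(2\pi)\}$, where $AC[0,2\pi]$ is the set of absolutely continuous functions on $[0,2\pi]$. For a function $\varphi$ defined almost everywhere on $[0,2\pi]$, $\varphi(k)$ denotes multiplication by $\varphi$ on $\mathcal K_1$ with its maximal domain $\{f\in\mathcal K_1\mid \varphi f\in\mathcal K_1\}$. Sums and products of unbounded operators have their natural domains: $D(A+B)=D(A)\cap D(B)$ and $D(AB)=\{f\in D(B)\mid Bf\in D(A)\}$. For an operator $A$ on a Hilbert space, the resolvent set is the set of $z\in\mathbb C$ such that $A-z$ is injective on $D(A)$, has dense range, and has a bounded inverse on its range; the spectrum $\sigma(A)$ is the complement of the resolvent set in $\mathbb C$. (If $A$ is closed, this is the usual spectrum; if $A$ is closable, $\sigma(A)$ is the spectrum of its closure $\bar A$.) 1. Let $g:\mathbb R\to\mathbb R$ be a twice continuously differentiable periodic function with period $2\pi$ whose derivative $g'$ has at most finitely many zeros in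 $[0,2\pi)$, and let $$T=-\frac12\Bigl(\frac1{g'(k)}P+P\frac1{g'(k)}\Bigr)$$ on $\mathcal K_1$ with its natural domain (the strong time operator of the multiplication operator $g(k)$). Then $\sigma(T)=\mathbb C$. 2. Let $\mathscr F_1:\ell^2(\mathbb Z)\to\mathcal K_1$ be the unitary Fourier transform, $(\mathscr F_1\psi)(k)=\sum_{x\in\mathbb Z}\psi(x)e^{-ixk}$, and let $$T_1=\mathscr F_1^{-1}\,\hat T_1\,\mathscr F_1,\qquad \hat T_1=\frac12\Bigl(\frac1{\sin k}P+P\frac1{\sin k}\Bigr),$$ with $\hat T_1$ on its natural domain (the strong time operator of the one-dimensional continuous-time quantum walk, whose Hamiltonian is $(H_1\psi)(x)=\frac12(\psi(x+1)+\psi(x-1))$ on $\ell^2(\mathbb Z)$). Then $\sigma(T_1)=\mathbb C$. -/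

import Mathlib

open MeasureTheory Set Filter

noncomputable section

namespace TimeOperator

section Operators

variable {E F : Type*} [NormedAddCommGroup E] [NormedSpace ℂ E]
  [NormedAddCommGroup F] [NormedSpace ℂ F]

/-- The product `A B` of two unbounded operators with its natural domain
`{x ∈ D(B) | B x ∈ D(A)}`. -/
def prodOp (A B : E →ₗ.[ℂ] E) : E →ₗ.[ℂ] E where
  domain := (A.domain.comap B.toFun).map B.domain.subtype
  toFun := A.toFun ∘ₗ
    { toFun := fun x => ⟨B ⟨x, by
          obtain ⟨y, _, hy⟩ := x.2
          exact hy ▸ y.2⟩, by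
          obtain ⟨x, y, hyA, rfl⟩ := x
          exact hyA⟩
      map_add' := fun x y => Subtype.ext (B.map_add ⟨x, _⟩ ⟨y, _⟩)
      map_smul' := fun c x => Subtype.ext (B.map_smul c ⟨x, _⟩) }

theorem mem_prodOp_graph (A B : E →ₗ.[ℂ] E) (x z : E) :
    (x, z) ∈ (prodOp A B).graph ↔ ∃ y, (x, y) ∈ B.graph ∧ (y, z) ∈ A.graph := by
  simp only [LinearPMap.mem_graph_iff]
  constructor
  · rintro ⟨⟨_, w, hw, rfl⟩, rfl, rfl⟩
    exact ⟨B w, ⟨w, rfl, rfl⟩, ⟨⟨B w, hw⟩, rfl, rfl⟩⟩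
  · rintro ⟨_, ⟨w, rfl, rfl⟩, ⟨v, hv, rfl⟩⟩
    have hw : w ∈ A.domain.comap B.toFun := by
      change B w ∈ A.domain
      rw [← hv]; exact v.2
    refine ⟨⟨w, w, hw, rfl⟩, rfl, ?_⟩
    change A _ = A _
    congr 1
    exact Subtype.ext hv.symm

/-- The operator `Φ⁻¹ A Φ`, with domain `{x | Φ x ∈ D(A)}`, for a unitary `Φ`. -/
def conjOp (Φ : F ≃ₗᵢ[ℂ] E) (A : E →ₗ.[ℂ] E) : F →ₗ.[ℂ] F where
  domain := A.domain.comap (Φ.toLinearEquiv : F →ₗ[ℂ] E)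
  toFun := (Φ.symm.toLinearEquiv : E →ₗ[ℂ] F) ∘ₗ A.toFun ∘ₗ
    (Φ.toLinearEquiv : F →ₗ[ℂ] E).restrict (fun _ hx => hx)

/-- The resolvent set of a (not necessarily closed) operator `A`: the `z` for which `A - z` is
injective with dense range and bounded inverse (the first clause says both that `A - z` is
injective and that its inverse is bounded). For closed `A` the range is then the whole space. -/
def resolventSet (A : E →ₗ.[ℂ] E) : Set ℂ :=
  {z | (∃ c > 0, ∀ x : A.domain, c * ‖(x : E)‖ ≤ ‖A x - z • (x : E)‖) ∧
    DenseRange (fun x : A.domain => A x - z • (x : E))}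

/-- The spectrum `σ(A)` of an unbounded operator. -/
def spectrum (A : E →ₗ.[ℂ] E) : Set ℂ := (resolventSet A)ᶜ

/-- For a closed operator on a Banach space: `z` is in the resolvent set if and only if
`A - z : D(A) → E` is a bijection with an inverse that is a bounded operator on `E`. -/
theorem mem_resolventSet_iff_of_isClosed [CompleteSpace E] {A : E →ₗ.[ℂ] E} (hA : A.IsClosed)
    (z : ℂ) : z ∈ resolventSet A ↔ ∃ R : E →L[ℂ] E, (∀ y, ∃ h : R y ∈ A.domain,
      A ⟨R y, h⟩ - z • R y = y) ∧ ∀ x : A.domain, R (A x - z • (x : E)) = x := by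
  constructor
  · rintro ⟨⟨c, hc, hb⟩, hd⟩
    let L : A.domain →ₗ[ℂ] E := A.toFun - z • A.domain.subtype
    have hLx (x : A.domain) : L x = A x - z • (x : E) := rfl
    have hsurj : Function.Surjective L := by
      intro y
      obtain ⟨u, hu, hlim⟩ := mem_closure_iff_seq_limit.1 (hd y)
      choose x hx using hu
      have hcau : CauchySeq (fun n => (x n : E)) := by
        rw [Metric.cauchySeq_iff']
        intro ε hε
        obtain ⟨N, hN⟩ := Metric.cauchySeq_iff'.1 hlim.cauchySeq (c * ε) (by positivity)
        refine ⟨N, fun n hn => ?_⟩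
        have h1 := hN n hn
        have h2 := hb (x n - x N)
        have h3 : A (x n - x N) - z • ((x n - x N : A.domain) : E) = u n - u N := by
          rw [← hx n, ← hx N]
          exact L.map_sub (x n) (x N)
        rw [h3, ← dist_eq_norm] at h2
        rw [dist_eq_norm]
        exact lt_of_mul_lt_mul_left (lt_of_le_of_lt h2 h1) hc.le
      obtain ⟨x₀, hx₀⟩ := cauchySeq_tendsto_of_complete hcau
      have hAx : Tendsto (fun n => A (x n)) atTop (nhds (y + z • x₀)) := by
        have := hlim.add (hx₀.const_smul z)
        refine this.congr fun n => ?_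
        rw [← hx n]; simp
      have hmem : (x₀, y + z • x₀) ∈ A.graph := by
        have hcl : _root_.IsClosed (A.graph : Set (E × E)) := hA
        exact hcl.mem_of_tendsto (hx₀.prodMk_nhds hAx)
          (Eventually.of_forall fun n => A.mem_graph (x n))
      obtain ⟨w, hw, hw'⟩ := (LinearPMap.mem_graph_iff _).1 hmem
      simp only at hw hw'
      refine ⟨w, ?_⟩
      rw [hLx, hw', hw]; simp
    have hinj : Function.Injective L := by
      rw [injective_iff_map_eq_zero]
      intro x hx
      have := hb x
      rw [← hLx, hx, norm_zero] at this
      have h0 : ‖(x : E)‖ ≤ 0 := by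
        by_contra! h
        have := mul_pos hc h
        linarith
      exact Subtype.ext (norm_le_zero_iff.1 h0)
    let e := LinearEquiv.ofBijective L ⟨hinj, hsurj⟩
    have heL (y : E) : L (e.symm y) = y := e.apply_symm_apply y
    refine ⟨(A.domain.subtype ∘ₗ (e.symm : E →ₗ[ℂ] A.domain)).mkContinuous c⁻¹ ?_, ?_, ?_⟩
    · intro y
      have := hb (e.symm y)
      rw [← hLx, heL] at this
      change ‖((e.symm y : A.domain) : E)‖ ≤ c⁻¹ * ‖y‖
      rw [inv_mul_eq_div, le_div_iff₀ hc, mul_comm]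
      exact this
    · intro y
      exact ⟨(e.symm y).2, heL y⟩
    · intro x
      have : e.symm (L x) = x := e.symm_apply_apply x
      exact congrArg Subtype.val this
  · rintro ⟨R, hR, hR'⟩
    refine ⟨⟨(‖R‖ + 1)⁻¹, by positivity, fun x => ?_⟩, ?_⟩
    · rw [inv_mul_eq_div, div_le_iff₀ (by positivity)]
      calc ‖(x : E)‖ = ‖R (A x - z • (x : E))‖ := by rw [hR']
        _ ≤ ‖R‖ * ‖A x - z • (x : E)‖ := R.le_opNorm _
        _ ≤ _ := by nlinarith [norm_nonneg (A x - z • (x : E))]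
    · refine Function.Surjective.denseRange fun y => ?_
      obtain ⟨h, hy⟩ := hR y
      exact ⟨⟨R y, h⟩, hy⟩

/-- A closable operator has the same spectrum as its closure. -/
theorem spectrum_closure {A : E →ₗ.[ℂ] E} (hA : A.IsClosable) :
    spectrum A.closure = spectrum A := by
  suffices h : resolventSet A.closure = resolventSet A by rw [spectrum, spectrum, h]
  have hle := A.le_closure
  have hext (x : A.domain) : A.closure ⟨x, hle.1 x.2⟩ = A x := (hle.2 rfl).symm
  have happrox (x : A.closure.domain) : ∃ u : ℕ → A.domain,
      Tendsto (fun n => (u n : E)) atTop (nhds (x : E)) ∧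
      Tendsto (fun n => A (u n)) atTop (nhds (A.closure x)) := by
    have h1 := A.closure.mem_graph x
    rw [← hA.graph_closure_eq_closure_graph] at h1
    obtain ⟨u, hu, hlim⟩ := mem_closure_iff_seq_limit.1
      (show ((x : E), A.closure x) ∈ _root_.closure (A.graph : Set (E × E)) from h1)
    choose v hv hv' using fun n => (LinearPMap.mem_graph_iff _).1 (hu n)
    refine ⟨v, ?_, ?_⟩
    · simpa only [hv] using! (continuous_fst.tendsto _).comp hlim
    · simpa only [hv'] using! (continuous_snd.tendsto _).comp hlim
  ext z
  constructor
  · rintro ⟨⟨c, hc, hb⟩, hd⟩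
    refine ⟨⟨c, hc, fun x => ?_⟩, ?_⟩
    · have := hb ⟨x, hle.1 x.2⟩
      rwa [hext] at this
    · refine Dense.of_closure (hd.mono ?_)
      rintro _ ⟨x, rfl⟩
      obtain ⟨u, hu, hu'⟩ := happrox x
      exact mem_closure_of_tendsto (hu'.sub (hu.const_smul z))
        (Eventually.of_forall fun n => ⟨u n, rfl⟩)
  · rintro ⟨⟨c, hc, hb⟩, hd⟩
    refine ⟨⟨c, hc, fun x => ?_⟩, ?_⟩
    · obtain ⟨u, hu, hu'⟩ := happrox x
      exact le_of_tendsto_of_tendsto' (hu.norm.const_mul c) (hu'.sub (hu.const_smul z)).norm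
        fun n => hb (u n)
    · refine hd.mono ?_
      rintro _ ⟨x, rfl⟩
      exact ⟨⟨x, hle.1 x.2⟩, by simp only [hext]⟩

end Operators

/-- The normalised Lebesgue measure `dk/2π` on `[0, 2π]`. -/
def dk : Measure ℝ := (ENNReal.ofReal (2 * Real.pi))⁻¹ • volume.restrict (Icc 0 (2 * Real.pi))

/-- The Hilbert space `L²([0, 2π], dk/2π)`. -/
abbrev K : Type := Lp ℂ 2 dk

/-- The multiplication operator by `φ` with its maximal domain `{f | φ f ∈ L²}`. -/
def mulOp (φ : ℝ → ℂ) : K →ₗ.[ℂ] K where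
  domain :=
    { carrier := {f | MemLp (fun k => φ k * f k) 2 dk}
      add_mem' := by
        intro f g hf hg
        refine (memLp_congr_ae ?_).1 (hf.add hg)
        filter_upwards [Lp.coeFn_add f g] with k hk
        exact (mul_add _ _ _).symm.trans (congrArg (φ k * ·) hk.symm)
      zero_mem' := by
        refine (memLp_congr_ae ?_).1 (MemLp.zero (ε := ℂ) (p := 2) (μ := dk))
        filter_upwards [Lp.coeFn_zero ℂ 2 dk] with k hk
        exact (mul_zero (φ k)).symm.trans (congrArg (φ k * ·) hk.symm)
      smul_mem' := by
        intro c f hf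
        refine (memLp_congr_ae ?_).1 (hf.const_smul c)
        filter_upwards [Lp.coeFn_smul c f] with k hk
        simp only [hk, Pi.smul_apply, smul_eq_mul]
        ring }
  toFun :=
    { toFun := fun f => MemLp.toLp (fun k => φ k * (f : K) k) f.2
      map_add' := by
        intro f g
        rw [← MemLp.toLp_add, MemLp.toLp_eq_toLp_iff]
        filter_upwards [Lp.coeFn_add (f : K) (g : K)] with k hk
        exact (congrArg (φ k * ·) hk).trans (mul_add _ _ _)
      map_smul' := by
        intro c f
        rw [RingHom.id_apply, ← MemLp.toLp_const_smul, MemLp.toLp_eq_toLp_iff]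
        filter_upwards [Lp.coeFn_smul c (f : K)] with k hk
        simp only [Submodule.coe_smul, hk, Pi.smul_apply, smul_eq_mul]
        ring }

theorem dk_absolutelyContinuous : dk ≪ volume.restrict (Icc 0 (2 * Real.pi)) :=
  Measure.smul_absolutelyContinuous

theorem absolutelyContinuous_dk : volume.restrict (Icc 0 (2 * Real.pi)) ≪ dk :=
  Measure.absolutelyContinuous_smul (ENNReal.inv_ne_zero.2 ENNReal.ofReal_ne_top)

/-- The graph of `P f = -i f'` with periodic boundary condition: the pairs `(f, h)` in `L²` such
that `f` has a representative `u`, absolutely continuous on `[0, 2π]` and with `u(0) = u(2π)`,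
whose derivative is `i h` almost everywhere. -/
def graphP : Submodule ℂ (K × K) where
  carrier := {q | ∃ u : ℝ → ℂ, AbsolutelyContinuousOnInterval u 0 (2 * Real.pi) ∧
    u 0 = u (2 * Real.pi) ∧ q.1 =ᵐ[dk] u ∧ ∀ᵐ k ∂dk, HasDerivAt u (Complex.I * q.2 k) k}
  add_mem' := by
    rintro ⟨f, h⟩ ⟨f', h'⟩ ⟨u, hu, hu0, hfu, hd⟩ ⟨u', hu', hu0', hfu', hd'⟩
    refine ⟨u + u', hu.add hu', by simp [hu0, hu0'], (Lp.coeFn_add f f').trans (hfu.add hfu'), ?_⟩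
    filter_upwards [hd, hd', Lp.coeFn_add h h'] with k h1 h2 h3
    have h4 : (h + h' : K) k = h k + h' k := h3
    change HasDerivAt (u + u') (Complex.I * (h + h' : K) k) k
    rw [h4, mul_add]
    exact h1.add h2
  zero_mem' := by
    refine ⟨fun _ => 0, ?_, rfl, Lp.coeFn_zero ℂ 2 dk, ?_⟩
    · exact LipschitzOnWith.absolutelyContinuousOnInterval (K := 0)
        ((LipschitzWith.const (0 : ℂ)).lipschitzOnWith)
    · filter_upwards [Lp.coeFn_zero ℂ 2 dk] with k hk
      have h4 : (0 : K) k = 0 := hk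
      change HasDerivAt _ (Complex.I * (0 : K) k) k
      rw [h4, mul_zero]
      exact hasDerivAt_const k (0 : ℂ)
  smul_mem' := by
    rintro c ⟨f, h⟩ ⟨u, hu, hu0, hfu, hd⟩
    refine ⟨fun k => c • u k, hu.const_smul c, by simp [hu0],
      (Lp.coeFn_smul c f).trans (hfu.const_smul c), ?_⟩
    filter_upwards [hd, Lp.coeFn_smul c h] with k h1 h2
    have h3 := h1.const_smul c
    have h4 : (c • h : K) k = c * h k := h2
    change HasDerivAt _ (Complex.I * (c • h : K) k) k
    rw [h4, mul_left_comm]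
    exact h3

/-- The self-adjoint momentum operator `P f = -i f'` on
`D(P) = {f ∈ AC[0, 2π] | f' ∈ L², f(0) = f(2π)}`. -/
def P : K →ₗ.[ℂ] K := graphP.toLinearPMap

theorem graph_P : P.graph = graphP := by
  refine Submodule.toLinearPMap_graph_eq graphP ?_
  rintro ⟨f, h⟩ ⟨u, hu, -, hfu, hd⟩ (rfl : f = 0)
  have hpi : (0 : ℝ) < 2 * Real.pi := by positivity
  have h0 : u =ᵐ[volume.restrict (Icc 0 (2 * Real.pi))] fun _ => 0 :=
    absolutelyContinuous_dk.ae_le (hfu.symm.trans (Lp.coeFn_zero ℂ 2 dk))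
  have hc : ContinuousOn u (Icc 0 (2 * Real.pi)) := by
    simpa [uIcc_of_le hpi.le] using hu.continuousOn
  have hz := Measure.eqOn_Icc_of_ae_eq volume hpi.ne h0 hc continuousOn_const
  have hae : ∀ᵐ k ∂dk, k ∈ Ioo 0 (2 * Real.pi) := by
    refine dk_absolutelyContinuous.ae_le ?_
    rw [← restrict_Ioo_eq_restrict_Icc]
    exact ae_restrict_mem measurableSet_Ioo
  refine Lp.ext ?_
  filter_upwards [hd, hae, Lp.coeFn_zero ℂ 2 dk] with k h1 h2 h3
  have h4 : HasDerivAt u 0 k :=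
    (hasDerivAt_const k (0 : ℂ)).congr_of_eventuallyEq
      ((eventually_of_mem (Icc_mem_nhds h2.1 h2.2)) hz)
  have h5 := h1.unique h4
  rw [h3]
  simpa using h5

/-- The operator `T = -(1/2) ((1/g') P + P (1/g'))` with its natural domain
`D((1/g') P) ∩ D(P (1/g'))`. -/
def T (g : ℝ → ℝ) : K →ₗ.[ℂ] K :=
  (-(1 / 2) : ℂ) • (prodOp (mulOp fun k => ((1 / deriv g k : ℝ) : ℂ)) P +
    prodOp P (mulOp fun k => ((1 / deriv g k : ℝ) : ℂ)))

/-- The function `k ↦ e^{-ixk}` in `L²([0, 2π], dk/2π)`. -/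
theorem memLp_wave (x : ℤ) :
    MemLp (fun k : ℝ => Complex.exp (-Complex.I * x * k)) 2 dk := by
  have : IsFiniteMeasure dk := by
    unfold dk
    exact Measure.smul_finite _ (by simp [Real.pi_pos])
  refine MemLp.of_bound (by fun_prop) 1 (Eventually.of_forall fun k => ?_)
  rw [Complex.norm_exp]
  simp

/-- The function `k ↦ e^{-ixk}` as an element of `L²([0, 2π], dk/2π)`. -/
def wave (x : ℤ) : K := (memLp_wave x).toLp _

instance factTwoPi : Fact (0 < 2 * Real.pi) := ⟨Real.two_pi_pos⟩

theorem measurePreserving_dk :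
    MeasurePreserving ((↑) : ℝ → AddCircle (2 * Real.pi)) dk AddCircle.haarAddCircle := by
  have h := AddCircle.measurePreserving_mk (2 * Real.pi) 0
  refine ⟨h.measurable, ?_⟩
  rw [zero_add] at h
  rw [dk, Measure.map_smul, ← restrict_Ioc_eq_restrict_Icc, h.map_eq,
    AddCircle.volume_eq_smul_haarAddCircle, smul_smul, ENNReal.inv_mul_cancel (by simp [Real.pi_pos])
      ENNReal.ofReal_ne_top,
    one_smul]

/-- Pull-back of square integrable functions from the circle to `[0, 2π]`. -/
def pullback : Lp ℂ 2 (AddCircle.haarAddCircle (T := 2 * Real.pi)) →ₗᵢ[ℂ] K :=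
  Lp.compMeasurePreservingₗᵢ ℂ _ measurePreserving_dk

theorem pullback_fourierLp (x : ℤ) : pullback (fourierLp 2 (-x)) = wave x := by
  refine Lp.ext ?_
  refine (Lp.coeFn_compMeasurePreserving _ measurePreserving_dk).trans ?_
  refine (measurePreserving_dk.quasiMeasurePreserving.ae_eq_comp (coeFn_fourierLp 2 (-x))).trans ?_
  refine EventuallyEq.trans (Eventually.of_forall fun k => ?_) (memLp_wave x).coeFn_toLp.symm
  simp only [Function.comp_apply, fourier_coe_apply]
  congr 1
  have : (Real.pi : ℂ) ≠ 0 := by exact_mod_cast Real.pi_ne_zero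
  push_cast
  field_simp

theorem pullback_surjective : Function.Surjective pullback := by
  intro f
  have hpi := Real.two_pi_pos
  let F : AddCircle (2 * Real.pi) → ℂ :=
    fun y => f ((AddCircle.measurableEquivIoc (2 * Real.pi) 0 y : ℝ))
  have hmeas : StronglyMeasurable F := by
    refine (Lp.stronglyMeasurable f).comp_measurable ?_
    exact measurable_subtype_coe.comp (AddCircle.measurableEquivIoc (2 * Real.pi) 0).measurable
  have hF : ∀ᵐ k : ℝ ∂dk, F (k : AddCircle (2 * Real.pi)) = f k := by
    refine dk_absolutelyContinuous.ae_le ?_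
    rw [← restrict_Ioc_eq_restrict_Icc]
    filter_upwards [ae_restrict_mem measurableSet_Ioc] with k hk
    have hk' : k ∈ Ioc 0 (0 + 2 * Real.pi) := by simpa using hk
    have := (AddCircle.measurableEquivIoc (2 * Real.pi) 0).apply_symm_apply ⟨k, hk'⟩
    exact congrArg (fun y : Ioc (0 : ℝ) (0 + 2 * Real.pi) => f (y : ℝ)) this
  have hL : MemLp F 2 AddCircle.haarAddCircle := by
    rw [← measurePreserving_dk.map_eq,
      memLp_map_measure_iff hmeas.aestronglyMeasurable measurePreserving_dk.measurable.aemeasurable]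
    exact (memLp_congr_ae hF).2 (Lp.memLp f)
  refine ⟨hL.toLp F, Lp.ext ?_⟩
  refine (Lp.coeFn_compMeasurePreserving _ measurePreserving_dk).trans ?_
  exact (measurePreserving_dk.quasiMeasurePreserving.ae_eq_comp hL.coeFn_toLp).trans hF

theorem orthonormal_wave : Orthonormal ℂ wave := by
  have h := (orthonormal_fourier (T := 2 * Real.pi)).comp (fun x : ℤ => -x) neg_injective
  have h2 := h.comp_linearIsometry pullback
  convert h2 using 1
  funext x
  exact (pullback_fourierLp x).symm

theorem span_wave : ⊤ ≤ (Submodule.span ℂ (range wave)).topologicalClosure := by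
  have h := span_fourierLp_closure_eq_top (T := 2 * Real.pi) (p := 2) (by simp)
  have h2 := pullback_surjective.denseRange.topologicalClosure_map_submodule
    (f := pullback.toContinuousLinearMap) h
  rw [← h2, Submodule.map_span]
  refine Submodule.topologicalClosure_mono (Submodule.span_mono ?_)
  rintro _ ⟨_, ⟨x, rfl⟩, rfl⟩
  refine ⟨-x, ?_⟩
  rw [← pullback_fourierLp, neg_neg]
  rfl

/-- The Fourier transform `ℓ²(ℤ) → L²([0, 2π], dk/2π)`: the unitary operator with
`(ℱ ψ)(k) = ∑ x, ψ(x) e^{-ixk}`. -/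
def fourierTransform : lp (fun _ : ℤ => ℂ) 2 ≃ₗᵢ[ℂ] K :=
  (HilbertBasis.mk orthonormal_wave span_wave).repr.symm

theorem hasSum_fourierTransform (ψ : lp (fun _ : ℤ => ℂ) 2) :
    HasSum (fun x : ℤ => ψ x • wave x) (fourierTransform ψ) := by
  simpa [fourierTransform] using
    (HilbertBasis.mk orthonormal_wave span_wave).hasSum_repr_symm ψ

/-- The operator `(1/2) ((1/sin k) P + P (1/sin k))` with its natural domain. -/
def hatT₁ : K →ₗ.[ℂ] K :=
  (1 / 2 : ℂ) • (prodOp (mulOp fun k => ((1 / Real.sin k : ℝ) : ℂ)) P +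
    prodOp P (mulOp fun k => ((1 / Real.sin k : ℝ) : ℂ)))

/-- The time operator `T₁ = ℱ⁻¹ ((1/2) ((1/sin k) P + P (1/sin k))) ℱ` on `ℓ²(ℤ)` of the
one-dimensional continuous-time quantum walk. -/
def T₁ : lp (fun _ : ℤ => ℂ) 2 →ₗ.[ℂ] lp (fun _ : ℤ => ℂ) 2 :=
  conjOp fourierTransform hatT₁

end TimeOperator

end

/-!
For every `z` the range of `T - z` fails to be dense, because the formal adjoint equation has a
square integrable solution, independently of any boundary condition at the zeros of `g'`.

Write `w = g'` and `S = (1/w) P + P (1/w)`, so that the operators in question are `c • S` with a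
constant `c ≠ 0`. If `x` is in the domain of `S`, then `x = w v` with `v` absolutely continuous and
`v(0) = v(2π)`, and off the zeros of `w` one has `S x = -2i (v' + w' v / (2w))`
(`exists_of_mem_symOp_domain`). Hence, for `κ = z / (2ic)`,
`e^{κ g} |w|^{1/2} (c S x - z x)` is, formally, `-2ic` times the derivative of the periodic function
`e^{κ g} |w|^{1/2} v`, and its integral vanishes: the complex conjugate of `e^{κ g} |w|^{1/2}` is a
nonzero bounded function orthogonal to the range of `c S - z` (`not_denseRange_symOp_sub`).

As `|w|^{1/2}` need not be absolutely continuous near the zeros of `w`, it is replaced by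
`(w² + δ)^{1/4}`. For `δ > 0` the integral is zero by the fundamental theorem of calculus
(`integral_weight_approx_eq_zero`). The derivative of the approximate weight contributes the term
`w w' v / (2 (w² + δ))`, which is dominated uniformly in `δ` by `w' v / w`. The latter is in `L²`
since both `(1/w) P x` and `P (x/w)` are, so dominated convergence gives the limit `δ → 0`
(`integral_weight_eq_zero`).

The operator `T₁` is unitarily equivalent to `(1/2) • S` for `g = -cos`.
-/

noncomputable section

namespace TimeOperator

open Topology

/-! ### Integration of derivatives over one period -/

instance isFiniteMeasure_dk : IsFiniteMeasure dk := by
  unfold dk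
  exact Measure.smul_finite _ (by simp [Real.pi_pos])

theorem ae_dk_mem_Ioo : ∀ᵐ k ∂dk, k ∈ Ioo 0 (2 * Real.pi) := by
  refine dk_absolutelyContinuous.ae_le ?_
  rw [← restrict_Ioo_eq_restrict_Icc]
  exact ae_restrict_mem measurableSet_Ioo

theorem absolutelyContinuousOnInterval_of_dist_le {X Y : Type*} [PseudoMetricSpace X]
    [PseudoMetricSpace Y] {u : ℝ → X} {v : ℝ → Y} {a b : ℝ}
    (hu : AbsolutelyContinuousOnInterval u a b)
    (h : ∀ s t, dist (v s) (v t) ≤ dist (u s) (u t)) : AbsolutelyContinuousOnInterval v a b :=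
  squeeze_zero (fun _ => Finset.sum_nonneg fun _ _ => dist_nonneg)
    (fun _ => Finset.sum_le_sum fun _ _ => h _ _) hu

theorem integral_deriv_eq_sub_of_real {u u' : ℝ → ℝ} {a b : ℝ} (hab : a ≤ b)
    (hu : AbsolutelyContinuousOnInterval u a b)
    (hd : ∀ᵐ k ∂volume.restrict (Icc a b), HasDerivAt u (u' k) k) :
    ∫ k in Icc a b, u' k = u b - u a := by
  rw [← hu.integral_deriv_eq_sub, intervalIntegral.integral_of_le hab,
    ← integral_Icc_eq_integral_Ioc]
  exact integral_congr_ae (hd.mono fun k hk => hk.deriv.symm)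

/-- The fundamental theorem of calculus for complex-valued absolutely continuous functions. -/
theorem integral_deriv_eq_sub {u u' : ℝ → ℂ} {a b : ℝ} (hab : a ≤ b)
    (hu : AbsolutelyContinuousOnInterval u a b)
    (hd : ∀ᵐ k ∂volume.restrict (Icc a b), HasDerivAt u (u' k) k)
    (hi : IntegrableOn u' (Icc a b)) :
    ∫ k in Icc a b, u' k = u b - u a := by
  have hre : ∫ k in Icc a b, (u' k).re = (u b).re - (u a).re := by
    refine integral_deriv_eq_sub_of_real hab (absolutelyContinuousOnInterval_of_dist_le hu
      (v := fun k => (u k).re) fun s t => ?_) ?_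
    · rw [Real.dist_eq, ← Complex.sub_re, dist_eq_norm]
      exact Complex.abs_re_le_norm _
    · exact hd.mono fun k hk => Complex.reCLM.hasFDerivAt.comp_hasDerivAt k hk
  have him : ∫ k in Icc a b, (u' k).im = (u b).im - (u a).im := by
    refine integral_deriv_eq_sub_of_real hab (absolutelyContinuousOnInterval_of_dist_le hu
      (v := fun k => (u k).im) fun s t => ?_) ?_
    · rw [Real.dist_eq, ← Complex.sub_im, dist_eq_norm]
      exact Complex.abs_im_le_norm _
    · exact hd.mono fun k hk => Complex.imCLM.hasFDerivAt.comp_hasDerivAt k hk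
  refine Complex.ext ?_ ?_
  · rw [Complex.sub_re, ← hre]
    exact (Complex.reCLM.integral_comp_comm hi).symm
  · rw [Complex.sub_im, ← him]
    exact (Complex.imCLM.integral_comp_comm hi).symm

theorem integral_dk_deriv_eq_zero {u u' : ℝ → ℂ}
    (hu : AbsolutelyContinuousOnInterval u 0 (2 * Real.pi)) (hper : u 0 = u (2 * Real.pi))
    (hd : ∀ᵐ k ∂dk, HasDerivAt u (u' k) k) (hi : Integrable u' dk) : ∫ k, u' k ∂dk = 0 := by
  have hi' : IntegrableOn u' (Icc 0 (2 * Real.pi)) := by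
    rw [dk, integrable_smul_measure (ENNReal.inv_ne_zero.2 ENNReal.ofReal_ne_top)
      (by simp [Real.pi_pos])] at hi
    exact hi
  rw [dk, integral_smul_measure, integral_deriv_eq_sub Real.two_pi_pos.le hu
    (absolutelyContinuous_dk.ae_le hd) hi', hper, sub_self, smul_zero]

/-! ### The domain of the symmetrized product -/

/-- The symmetrized product `φ P + P φ` of a multiplication operator and `P`, with its natural
domain. -/
def symOp (φ : ℝ → ℂ) : K →ₗ.[ℂ] K := prodOp (mulOp φ) P + prodOp P (mulOp φ)

theorem mulOp_graph_ae {φ : ℝ → ℂ} {f h : K} (hfh : (f, h) ∈ (mulOp φ).graph) :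
    h =ᵐ[dk] fun k => φ k * f k := by
  obtain ⟨y, hy, hy'⟩ := (LinearPMap.mem_graph_iff _).1 hfh
  simp only at hy hy'
  subst hy hy'
  exact MemLp.coeFn_toLp y.2

/-- An element of the domain of `S = (1/w) P + P (1/w)` is `w v` for a periodic absolutely
continuous `v`. Here `p = (1/w) P x` and `q = P (x/w) = -i v'`; the product rule for `w v` relates
them by `w' v = i w (p - q)`, so that `w' v / w` is square integrable. -/
theorem exists_of_mem_symOp_domain {w : ℝ → ℝ} (hw : ContDiff ℝ 1 w)
    (hw0 : ∀ᵐ k ∂dk, w k ≠ 0) (x : (symOp fun k => ((1 / w k : ℝ) : ℂ)).domain) :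
    ∃ (v : ℝ → ℂ) (p q : K), AbsolutelyContinuousOnInterval v 0 (2 * Real.pi) ∧
      v 0 = v (2 * Real.pi) ∧ (x : K) =ᵐ[dk] (fun k => w k * v k) ∧
      (∀ᵐ k ∂dk, HasDerivAt v (Complex.I * q k) k) ∧
      (∀ᵐ k ∂dk, ((deriv w k : ℝ) : ℂ) * v k = w k * (Complex.I * (p k - q k))) ∧
      symOp (fun k => ((1 / w k : ℝ) : ℂ)) x = p + q := by
  obtain ⟨x, hx1, hx2⟩ := x
  obtain ⟨y, hxy, hyp⟩ := (mem_prodOp_graph _ _ _ _).1 (LinearPMap.mem_graph _ ⟨x, hx1⟩)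
  obtain ⟨y', hxy', hyq⟩ := (mem_prodOp_graph _ _ _ _).1 (LinearPMap.mem_graph _ ⟨x, hx2⟩)
  rw [graph_P] at hxy hyq
  obtain ⟨u, hu, -, hxu, hdu⟩ := hxy
  obtain ⟨v, hv, hv0, hyv, hdv⟩ := hyq
  have hp := mulOp_graph_ae hyp
  have hy' := mulOp_graph_ae hxy'
  have hxv : x =ᵐ[dk] fun k => w k * v k := by
    filter_upwards [hy', hyv, hw0] with k h1 h2 h3
    have h3' : (w k : ℂ) ≠ 0 := by exact_mod_cast h3
    rw [← h2, h1]
    push_cast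
    field_simp
  refine ⟨v, prodOp _ _ ⟨x, hx1⟩, prodOp _ _ ⟨x, hx2⟩, hv, hv0, hxv, hdv, ?_, rfl⟩
  have hpi := Real.two_pi_pos
  -- two continuous representatives of the same class agree everywhere on the interval
  have huv : EqOn u (fun k => w k * v k) (Icc 0 (2 * Real.pi)) := by
    refine Measure.eqOn_Icc_of_ae_eq volume hpi.ne
      (absolutelyContinuous_dk.ae_le (hxu.symm.trans hxv)) ?_ ?_
    · simpa [uIcc_of_le hpi.le] using hu.continuousOn
    · refine (Complex.continuous_ofReal.comp hw.continuous).continuousOn.mul ?_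
      simpa [uIcc_of_le hpi.le] using hv.continuousOn
  filter_upwards [hdu, hdv, hp, hw0, ae_dk_mem_Ioo] with k h1 h2 h3 h4 h5
  have h4' : (w k : ℂ) ≠ 0 := by exact_mod_cast h4
  have hdw : HasDerivAt (fun k => (w k : ℂ)) ((deriv w k : ℝ) : ℂ) k :=
    ((hw.differentiable one_ne_zero).differentiableAt.hasDerivAt).ofReal_comp
  have h6 := h1.unique ((hdw.mul h2).congr_of_eventuallyEq
    (eventually_of_mem (Icc_mem_nhds h5.1 h5.2) huv))
  rw [h3]
  push_cast
  field_simp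
  linear_combination -h6

/-! ### The weight and its approximations -/

/-- The function `(t² + δ)^{1/4}`: for `δ > 0` a positive smooth approximation of its value
`√|t|` at `δ = 0`. -/
def rootAbs (δ t : ℝ) : ℝ := √√(t ^ 2 + δ)

theorem hasDerivAt_rootAbs {δ : ℝ} (hδ : 0 < δ) (t : ℝ) :
    HasDerivAt (rootAbs δ) (rootAbs δ t * (t / (t ^ 2 + δ)) / 2) t := by
  have h0 : 0 < t ^ 2 + δ := by positivity
  have h1 : 0 < √(t ^ 2 + δ) := Real.sqrt_pos.2 h0
  have h2 : 0 < √√(t ^ 2 + δ) := Real.sqrt_pos.2 h1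
  have h : HasDerivAt (fun y : ℝ => y ^ 2 + δ) (2 * t) t := by
    simpa using (hasDerivAt_pow 2 t).add_const δ
  refine ((h.sqrt h0.ne').sqrt h1.ne').congr_deriv ?_
  have e1 := Real.sq_sqrt h1.le
  have e2 := Real.sq_sqrt h0.le
  unfold rootAbs
  generalize √√(t ^ 2 + δ) = b at *
  generalize √(t ^ 2 + δ) = a at *
  rw [← e2, ← e1]
  field_simp

theorem continuous_rootAbs (δ : ℝ) : Continuous (rootAbs δ) := by
  unfold rootAbs
  fun_prop

theorem contDiff_rootAbs {δ : ℝ} (hδ : 0 < δ) : ContDiff ℝ 1 (rootAbs δ) := by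
  have h0 (t : ℝ) : 0 < t ^ 2 + δ := by positivity
  exact ((contDiff_id.pow 2).add contDiff_const |>.sqrt fun t => (h0 t).ne').sqrt
    fun t => (Real.sqrt_pos.2 (h0 t)).ne'

theorem rootAbs_mono {δ δ' : ℝ} (h : δ ≤ δ') (t : ℝ) : rootAbs δ t ≤ rootAbs δ' t := by
  unfold rootAbs
  gcongr

/-- The weight `e^{κ g} (w² + δ)^{1/4}`, where `w = g'`. For `δ = 0` and suitable `κ` its complex
conjugate is orthogonal to the range of `c • symOp (1 / w) - z`. -/
def weight (κ : ℂ) (g : ℝ → ℝ) (δ k : ℝ) : ℂ :=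
  Complex.exp (κ * g k) * rootAbs δ (deriv g k)

section

variable {g : ℝ → ℝ}

theorem continuous_weight (hg : ContDiff ℝ 2 g) (κ : ℂ) (δ : ℝ) : Continuous (weight κ g δ) := by
  have h1 := hg.continuous
  have h2 := (continuous_rootAbs δ).comp (hg.continuous_deriv (by norm_num))
  unfold weight
  simp only [Function.comp_def] at h2
  fun_prop

/-- The weights are bounded on `[0, 2π]` uniformly in `δ ≤ 1`. -/
theorem norm_weight_le (hg : ContDiff ℝ 2 g) (κ : ℂ) :
    ∃ C, ∀ δ ≤ 1, ∀ᵐ k ∂dk, ‖weight κ g δ k‖ ≤ C := by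
  obtain ⟨C, hC⟩ := (isCompact_Icc (a := 0) (b := 2 * Real.pi)).exists_bound_of_continuousOn
    (continuous_weight hg κ 1).continuousOn
  refine ⟨C, fun δ hδ => ae_dk_mem_Ioo.mono fun k hk => le_trans ?_ (hC k (Ioo_subset_Icc_self hk))⟩
  have h := rootAbs_mono hδ (deriv g k)
  have h0 (δ : ℝ) : 0 ≤ rootAbs δ (deriv g k) := Real.sqrt_nonneg _
  simp only [weight, norm_mul, Complex.norm_real, Real.norm_of_nonneg (h0 _)]
  gcongr

theorem norm_ratio_le {δ : ℝ} (hδ : 0 ≤ δ) (t : ℝ) (c : ℂ) :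
    ‖((t ^ 2 / (t ^ 2 + δ) : ℝ) : ℂ) * c / 2‖ ≤ ‖c‖ := by
  have h1 : t ^ 2 / (t ^ 2 + δ) ≤ 1 := div_le_one_of_le₀ (by linarith) (by positivity)
  rw [norm_div, norm_mul, Complex.norm_real, Real.norm_of_nonneg (by positivity),
    Complex.norm_ofNat]
  nlinarith [mul_le_mul_of_nonneg_right h1 (norm_nonneg c), norm_nonneg c]

theorem hasDerivAt_weight (hg : ContDiff ℝ 2 g) (κ : ℂ) {δ : ℝ} (hδ : 0 < δ) (k : ℝ) :
    HasDerivAt (weight κ g δ) (weight κ g δ k * (κ * (deriv g k : ℝ) +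
      ((deriv g k / (deriv g k ^ 2 + δ) * deriv (deriv g) k / 2 : ℝ) : ℂ))) k := by
  have hg' : ContDiff ℝ 1 (deriv g) := hg.deriv'
  have h1 : HasDerivAt (fun k => (g k : ℂ)) (deriv g k : ℝ) k :=
    (hg.differentiable two_ne_zero).differentiableAt.hasDerivAt.ofReal_comp
  have h2 := ((hasDerivAt_rootAbs hδ (deriv g k)).comp k
    (hg'.differentiable one_ne_zero).differentiableAt.hasDerivAt).ofReal_comp
  refine ((h1.const_mul κ).cexp.mul h2).congr_deriv ?_
  simp only [weight, Function.comp_apply]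
  push_cast
  ring

theorem absolutelyContinuousOnInterval_weight (hg : ContDiff ℝ 2 g) (κ : ℂ) {δ : ℝ} (hδ : 0 < δ)
    (a b : ℝ) : AbsolutelyContinuousOnInterval (weight κ g δ) a b := by
  have hg' : ContDiff ℝ 1 (deriv g) := hg.deriv'
  have h1 : ContDiff ℝ 1 g := hg.of_le one_le_two
  have h2 : ContDiff ℝ 1 (weight κ g δ) :=
    (contDiff_const.mul (Complex.ofRealCLM.contDiff.comp h1)).cexp.mul
      (Complex.ofRealCLM.contDiff.comp ((contDiff_rootAbs hδ).comp hg'))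
  exact h2.contDiffOn.absolutelyContinuousOnInterval

/-! ### Orthogonality to the range -/

/-- For `δ > 0` the integrand is the derivative of the periodic function `weight κ g δ * v`: the
term `w w' v / (2 (w² + δ))` from the derivative of the weight is rewritten using the relation
`w' v = i w (p - q)`. -/
theorem integral_weight_approx_eq_zero (hg : ContDiff ℝ 2 g)
    (hper : Function.Periodic g (2 * Real.pi)) (κ : ℂ) {v : ℝ → ℂ} {x p q : K}
    (hv : AbsolutelyContinuousOnInterval v 0 (2 * Real.pi)) (hv0 : v 0 = v (2 * Real.pi))
    (hx : x =ᵐ[dk] fun k => deriv g k * v k)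
    (hd : ∀ᵐ k ∂dk, HasDerivAt v (Complex.I * q k) k)
    (hpq : ∀ᵐ k ∂dk, ((deriv (deriv g) k : ℝ) : ℂ) * v k =
      deriv g k * (Complex.I * (p k - q k))) {δ : ℝ} (hδ : 0 < δ)
    (hδ1 : δ ≤ 1) :
    ∫ k, weight κ g δ k * (κ * x k + Complex.I * q k +
      ((deriv g k ^ 2 / (deriv g k ^ 2 + δ) : ℝ) : ℂ) * (Complex.I * (p k - q k)) / 2) ∂dk = 0 := by
  have hg' := hg.continuous_deriv one_le_two
  have hx' : Integrable x dk := (Lp.memLp x).integrable one_le_two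
  have hp' : Integrable p dk := (Lp.memLp p).integrable one_le_two
  have hq' : Integrable q dk := (Lp.memLp q).integrable one_le_two
  have hdper : deriv g (2 * Real.pi) = deriv g 0 := by
    simpa [hper.funext] using (deriv_comp_add_const g (2 * Real.pi) 0).symm
  have hgper : g (2 * Real.pi) = g 0 := by simpa using hper 0
  refine integral_dk_deriv_eq_zero
    ((absolutelyContinuousOnInterval_weight hg κ hδ 0 (2 * Real.pi)).fun_smul hv)
    (by simp only [weight, hdper, hgper, hv0]) ?_ ?_
  · filter_upwards [hx, hd, hpq] with k h1 h2 h3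
    refine ((hasDerivAt_weight hg κ hδ k).mul h2).congr_deriv ?_
    rw [h1]
    push_cast
    linear_combination (weight κ g δ k *
      ((deriv g k : ℝ) / ((deriv g k : ℝ) ^ 2 + δ : ℂ)) / 2) * h3
  · obtain ⟨C, hC⟩ := norm_weight_le hg κ
    refine Integrable.bdd_mul (c := C) ?_ (continuous_weight hg κ δ).aestronglyMeasurable (hC δ hδ1)
    refine ((hx'.const_mul κ).add (hq'.const_mul Complex.I)).add ?_
    refine ((hp'.sub hq').const_mul Complex.I).mono ?_
      (Eventually.of_forall fun k => norm_ratio_le hδ.le _ _)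
    have h4 : Measurable fun k => ((deriv g k ^ 2 / (deriv g k ^ 2 + δ) : ℝ) : ℂ) := by
      have := hg'.measurable
      fun_prop
    exact ((h4.aestronglyMeasurable).mul
      ((hp'.sub hq').const_mul Complex.I).aestronglyMeasurable).mul_const _ |>.congr
        (Eventually.of_forall fun k => (div_eq_mul_inv _ _).symm)

/-- The limit `δ → 0` of `integral_weight_approx_eq_zero`. -/
theorem integral_weight_eq_zero (hg : ContDiff ℝ 2 g)
    (hper : Function.Periodic g (2 * Real.pi)) (κ : ℂ) (hw0 : ∀ᵐ k ∂dk, deriv g k ≠ 0)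
    (x : (symOp fun k => ((1 / deriv g k : ℝ) : ℂ)).domain) :
    ∫ k, weight κ g 0 k * (κ * (x : K) k +
      Complex.I / 2 * symOp (fun k => ((1 / deriv g k : ℝ) : ℂ)) x k) ∂dk = 0 := by
  have hg' : ContDiff ℝ 1 (deriv g) := hg.deriv'
  obtain ⟨v, p, q, hv, hv0, hx, hd, hpq, hS⟩ := exists_of_mem_symOp_domain hg' hw0 x
  have hx' : Integrable (x : K) dk := (Lp.memLp _).integrable one_le_two
  have hp' : Integrable p dk := (Lp.memLp p).integrable one_le_two
  have hq' : Integrable q dk := (Lp.memLp q).integrable one_le_two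
  obtain ⟨C, hC⟩ := norm_weight_le hg κ
  let G (δ k : ℝ) : ℂ := weight κ g δ k * (κ * (x : K) k + Complex.I * q k +
      ((deriv g k ^ 2 / (deriv g k ^ 2 + δ) : ℝ) : ℂ) * (Complex.I * (p k - q k)) / 2)
  have hsmall : ∀ᶠ δ : ℝ in 𝓝[>] 0, δ ∈ Ioc 0 1 := Ioc_mem_nhdsGT one_pos
  have hlim : Tendsto (fun δ => ∫ k, G δ k ∂dk) (𝓝[>] 0) (𝓝 (∫ k, G 0 k ∂dk)) := by
    refine tendsto_integral_filter_of_dominated_convergence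
      (fun k => C * (‖κ * (x : K) k‖ + ‖Complex.I * q k‖ + ‖Complex.I * (p k - q k)‖)) ?_ ?_ ?_ ?_
    · refine Eventually.of_forall fun δ => ?_
      have h1 := (continuous_weight hg κ δ).measurable
      have h2 := hg'.continuous.measurable
      have h3 := (Lp.stronglyMeasurable (x : K)).measurable
      have h4 := (Lp.stronglyMeasurable p).measurable
      have h5 := (Lp.stronglyMeasurable q).measurable
      exact Measurable.aestronglyMeasurable (by fun_prop)
    · filter_upwards [hsmall] with δ hδ
      filter_upwards [hC δ hδ.2] with k hk
      rw [norm_mul]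
      gcongr
      · exact (norm_nonneg _).trans hk
      · exact (norm_add_le _ _).trans (add_le_add (norm_add_le _ _) (norm_ratio_le hδ.1.le _ _))
    · exact (((hx'.const_mul κ).norm.add (hq'.const_mul _).norm).add
        ((hp'.sub hq').const_mul _).norm).const_mul C
    -- off the zeros of `g'` the integrand is continuous in `δ` at `0`, where the quotient is `1`
    · filter_upwards [hw0] with k hk
      refine tendsto_nhdsWithin_of_tendsto_nhds (ContinuousAt.tendsto ?_)
      have h1 : ContinuousAt (fun δ => deriv g k ^ 2 / (deriv g k ^ 2 + δ)) 0 :=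
        continuousAt_const.div (by fun_prop) (by simpa using hk)
      have h2 : Continuous fun δ => weight κ g δ k := by
        unfold weight rootAbs
        fun_prop
      have h3 : ContinuousAt
          (fun δ => ((deriv g k ^ 2 / (deriv g k ^ 2 + δ) : ℝ) : ℂ)) 0 :=
        Complex.continuous_ofReal.continuousAt.comp h1
      exact h2.continuousAt.mul (continuousAt_const.add ((h3.mul continuousAt_const).div_const _))
  have hG0 : ∫ k, G 0 k ∂dk = 0 := by
    refine tendsto_nhds_unique hlim (tendsto_const_nhds.congr' ?_)
    filter_upwards [hsmall] with δ hδ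
    exact (integral_weight_approx_eq_zero hg hper κ hv hv0 hx hd hpq hδ.1 hδ.2).symm
  rw [hS, ← hG0]
  refine integral_congr_ae ?_
  filter_upwards [hw0, Lp.coeFn_add p q] with k h1 h2
  simp only [G, add_zero, div_self (pow_ne_zero 2 h1), h2, Pi.add_apply, Complex.ofReal_one]
  ring

theorem ae_deriv_ne_zero (hfin : {k ∈ Ico 0 (2 * Real.pi) | deriv g k = 0}.Finite) :
    ∀ᵐ k ∂dk, deriv g k ≠ 0 := by
  have h : ∀ᵐ k, k ∉ {k ∈ Ico 0 (2 * Real.pi) | deriv g k = 0} :=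
    measure_eq_zero_iff_ae_notMem.1 (hfin.measure_zero volume)
  filter_upwards [ae_dk_mem_Ioo, dk_absolutelyContinuous.ae_le (ae_restrict_of_ae h)]
    with k h1 h2 h3
  exact h2 ⟨⟨h1.1.le, h1.2⟩, h3⟩

/-- The conjugate of `weight κ g 0` with `κ = z / (2ic)` is orthogonal to the range of
`c ((1/g') P + P (1/g')) - z`, and it is nonzero almost everywhere. -/
theorem not_denseRange_symOp_sub (hg : ContDiff ℝ 2 g)
    (hper : Function.Periodic g (2 * Real.pi)) (hw0 : ∀ᵐ k ∂dk, deriv g k ≠ 0)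
    {c : ℂ} (hc : c ≠ 0) (z : ℂ) :
    ¬ DenseRange fun x : (c • symOp fun k => ((1 / deriv g k : ℝ) : ℂ)).domain =>
      (c • symOp fun k => ((1 / deriv g k : ℝ) : ℂ)) x - z • (x : K) := by
  intro hdense
  obtain ⟨κ, hκ⟩ : ∃ κ : ℂ, κ * (2 * Complex.I * c) = z :=
    ⟨_, div_mul_cancel₀ z (by simp [hc])⟩
  obtain ⟨C, hC⟩ := norm_weight_le hg κ
  have hψ : MemLp (fun k => starRingEnd ℂ (weight κ g 0 k)) 2 dk := by
    refine MemLp.of_bound ?_ C ?_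
    · exact (Complex.continuous_conj.comp (continuous_weight hg κ 0)).aestronglyMeasurable
    · simpa using hC 0 zero_le_one
  have horth : hψ.toLp _ = 0 := by
    refine Dense.eq_zero_of_inner_left ℂ hdense ?_
    rintro _ ⟨x, rfl⟩
    have h0 := integral_weight_eq_zero hg hper κ hw0 x
    have h1 : (c • symOp fun k => ((1 / deriv g k : ℝ) : ℂ)) x
      = c • symOp (fun k => ((1 / deriv g k : ℝ) : ℂ)) x := rfl
    -- the integrand of the inner product is `-2ic` times that of `h0`
    rw [L2.inner_def, ← mul_zero (-2 * Complex.I * c), ← h0, ← integral_const_mul]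
    refine integral_congr_ae ?_
    simp only [h1]
    filter_upwards [hψ.coeFn_toLp,
      Lp.coeFn_sub (c • symOp (fun k => ((1 / deriv g k : ℝ) : ℂ)) x) (z • (x : K)),
      Lp.coeFn_smul c (symOp (fun k => ((1 / deriv g k : ℝ) : ℂ)) x),
      Lp.coeFn_smul z (x : K)] with k h2 h3 h4 h5
    rw [h2, h3]
    simp only [Pi.sub_apply, h4, h5, Pi.smul_apply, smul_eq_mul, RCLike.inner_apply,
      Complex.conj_conj]
    linear_combination (weight κ g 0 k * (x : K) k) * hκ + (c * weight κ g 0 k *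
      symOp (fun k => ((1 / deriv g k : ℝ) : ℂ)) x k) * Complex.I_sq
  have hne : ∀ᵐ k ∂dk, False := by
    filter_upwards [hψ.coeFn_toLp, Lp.coeFn_zero ℂ 2 dk, hw0] with k h1 h2 h3
    rw [horth, h2] at h1
    have h4 : weight κ g 0 k = 0 := by simpa using h1.symm
    have h5 : 0 < rootAbs 0 (deriv g k) :=
      Real.sqrt_pos.2 (Real.sqrt_pos.2 (by positivity))
    exact mul_ne_zero (Complex.exp_ne_zero _) (Complex.ofReal_ne_zero.2 h5.ne') h4
  have hdk : dk = 0 := by simpa using hne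
  have hvol := absolutelyContinuous_dk (s := univ) (by simp [hdk])
  simp [Real.pi_pos.not_ge] at hvol

end

/-! ### The spectra -/

theorem spectrum_eq_univ_of_not_denseRange {E : Type*} [NormedAddCommGroup E] [NormedSpace ℂ E]
    {A : E →ₗ.[ℂ] E} (h : ∀ z : ℂ, ¬ DenseRange fun x : A.domain => A x - z • (x : E)) :
    spectrum A = univ :=
  eq_univ_of_forall fun z hz => h z hz.2

theorem denseRange_sub_of_conjOp {E F : Type*} [NormedAddCommGroup E] [NormedSpace ℂ E]
    [NormedAddCommGroup F] [NormedSpace ℂ F] (Φ : F ≃ₗᵢ[ℂ] E) {A : E →ₗ.[ℂ] E} {z : ℂ}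
    (h : DenseRange fun x : (conjOp Φ A).domain => conjOp Φ A x - z • (x : F)) :
    DenseRange fun x : A.domain => A x - z • (x : E) := by
  refine (Φ.surjective.denseRange.comp h Φ.continuous).mono ?_
  rintro _ ⟨x, rfl⟩
  have h1 : Φ (conjOp Φ A x) = A ⟨Φ x, x.2⟩ := Φ.apply_symm_apply _
  exact ⟨⟨Φ x, x.2⟩, by simp [h1]⟩

theorem spectrum_T_eq_univ {g : ℝ → ℝ} (hg : ContDiff ℝ 2 g)
    (hper : Function.Periodic g (2 * Real.pi))
    (hfin : {k ∈ Ico 0 (2 * Real.pi) | deriv g k = 0}.Finite) : spectrum (T g) = univ :=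
  spectrum_eq_univ_of_not_denseRange
    (not_denseRange_symOp_sub hg hper (ae_deriv_ne_zero hfin) (by norm_num))

theorem finite_zeros_sin : {k ∈ Ico 0 (2 * Real.pi) | Real.sin k = 0}.Finite := by
  refine ((finite_Icc (0 : ℤ) 2).image fun n : ℤ => (n : ℝ) * Real.pi).subset ?_
  rintro k ⟨⟨h0, h1⟩, hk⟩
  obtain ⟨n, rfl⟩ := Real.sin_eq_zero_iff.1 hk
  refine ⟨n, ⟨?_, ?_⟩, rfl⟩
  · exact_mod_cast nonneg_of_mul_nonneg_left h0 Real.pi_pos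
  · exact_mod_cast (lt_of_mul_lt_mul_right h1 Real.pi_pos.le).le

/-- The time operator of the quantum walk is, up to the Fourier transform, the operator
`(1/2) ((1/g') P + P (1/g'))` for `g = -cos`. -/
theorem spectrum_T₁_eq_univ : spectrum T₁ = univ := by
  refine spectrum_eq_univ_of_not_denseRange fun z hz => ?_
  have hderiv : deriv (fun k => -Real.cos k) = Real.sin := by
    funext k
    simp
  have h := not_denseRange_symOp_sub (g := fun k => -Real.cos k) (c := 1 / 2)
    Real.contDiff_cos.neg (fun k => by simp) (ae_deriv_ne_zero ?_) (by norm_num) z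
  · rw [hderiv] at h
    exact h (denseRange_sub_of_conjOp fourierTransform hz)
  · rw [hderiv]
    exact finite_zeros_sin

end TimeOperator

end

theorem mainTheorem6 :
    (∀ g : ℝ → ℝ, ContDiff ℝ 2 g → Function.Periodic g (2 * Real.pi) →
      {k ∈ Set.Ico 0 (2 * Real.pi) | deriv g k = 0}.Finite →
      TimeOperator.spectrum (TimeOperator.T g) = Set.univ) ∧
    TimeOperator.spectrum TimeOperator.T₁ = Set.univ :=
  ⟨fun _ => TimeOperator.spectrum_T_eq_univ, TimeOperator.spectrum_T₁_eq_univ⟩
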